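/- For $a\in\mathbb{R}$ and $k\in\mathbb{N}_0$ let $\binom{a}{k}:=\frac{a(a-1)\cdots(a-k+1)}{k!}$ (with $\binom{a}{0}:=1$). Let $c<0$, let $l\ge 1$ be an integer, and let $n:=-cl$. For $k\in\mathbb{N}_0$ and $x\in[0,-\frac1c]$ put $$p_{n,k}^{[c]}(x):=\binom{-n/c}{k}(-cx)^k(1+cx)^{-\frac nc-k},\qquad S_{n,c}(x):=\sum_{k=0}^{\infty}\bigl(p_{n,k}^{[c]}(x)\bigr)^2,$$ where $0^0:=1$ and the terms with $k>l$ are $0$, because their binomial coefficient vanishes. For $t\in[0,-\frac1c]$ put $$T:=t+ct^2,\qquad \rho:=\sqrt{n^2+c^2},\qquad R:=\sqrt{16\rho^2T^2+8cT+1}.$$ **Theorem 4.1.** For all $c<0$, all integers $l\ge1$ with $n=-cl$, and all $t\in[0,-\frac1c]$, $$S_{n,c}(t)^2\le\frac{2}{1+4cT+R}\left(\frac{1}{R+4nT}\right)^{n/c}\left(\frac{\rho R+4\rho^2T+c}{\rho+c}\right)^{\rho/c}.$$ -/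

import Mathlib

/-- The generalized binomial coefficient `a (a - 1) ⋯ (a - k + 1) / k!` of a real number `a`;
the empty product gives the value `1` for `k = 0`. -/
noncomputable def realBinom (a : ℝ) (k : ℕ) : ℝ :=
  (∏ i ∈ Finset.range k, (a - (i : ℝ))) / (Nat.factorial k : ℝ)

/-- The probability weights `p_{n,k}^{[c]}(x)`; binomial for `c < 0`, Poisson for `c = 0`,
negative binomial for `c > 0`. The second power has a real exponent and is only used at bases
`1 + c x ≥ 0`; the convention is `0 ^ 0 = 1`. -/
noncomputable def probWeight (n c : ℝ) (k : ℕ) (x : ℝ) : ℝ :=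
  if c = 0 then (n * x) ^ k / (Nat.factorial k : ℝ) * Real.exp (-(n * x))
  else realBinom (-n / c) k * (-c * x) ^ k * (1 + c * x) ^ (-n / c - (k : ℝ))

/-- The index of coincidence `S_{n,c}(x) = ∑_k (p_{n,k}^{[c]}(x))²`. -/
noncomputable def coincidenceIndex (n c : ℝ) (x : ℝ) : ℝ :=
  ∑' k : ℕ, (probWeight n c k x) ^ 2

/-- For `c < 0` and `n = -c l` the series defining the index of coincidence is a finite sum. -/
theorem coincidenceIndex_summable (c : ℝ) (hc : c < 0) (l : ℕ) (x : ℝ) :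
    Summable fun k : ℕ => (probWeight (-c * (l : ℝ)) c k x) ^ 2 := by
  apply summable_of_ne_finset_zero (s := Finset.range (l + 1))
  intro k hk
  have hk' : l < k := by simpa using hk
  have h1 : -(-c * (l : ℝ)) / c = l := by
    rw [neg_mul, neg_neg, mul_div_cancel_left₀ _ hc.ne]
  have h2 : realBinom (l : ℝ) k = 0 := by
    unfold realBinom
    rw [Finset.prod_eq_zero (Finset.mem_range.2 hk') (sub_self (l : ℝ)), zero_div]
  unfold probWeight
  rw [if_neg hc.ne, h1, h2]
  simp

/-! Put x = -ct. Then S is the index of coincidence of a binomial law with l trials and success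
probability x, which is symmetric under x ↦ 1 - x, so it is a function F of y = |1 - 2x| in [0, 1].
The hypergeometric equation of ∑ (l choose k)² z^k, at z = ((1-y)/(1+y))², becomes a second-order
equation for F, hence a Riccati equation for g = F'/F: y(1-y²)g' = (2l - (2l-2)y²)g - 2ly -
y(1-y²)g². Its right side is negative below the smaller root γ(y), and γ increases to γ(1) = l =
g(1). If g fell below γ at some point, it could never climb back to l; so g ≥ γ
(`riccatiRoot_le_logDeriv`). Integrating from y to 1, where F = 1, bounds 2 log F by an integral
with the elementary closed form `logBound` in u = 1 - y². -/

/-! ### The hypergeometric polynomial and its differential equation -/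

open Polynomial in
/-- The polynomial `∑ k, (l choose k)² X ^ k`. -/
noncomputable def chooseSqPoly (l : ℕ) : ℝ[X] :=
  ∑ k ∈ Finset.range (l + 1), C ((l.choose k : ℝ) ^ 2) * X ^ k

open Polynomial in
theorem chooseSqPoly_coeff (l k : ℕ) : (chooseSqPoly l).coeff k = (l.choose k : ℝ) ^ 2 := by
  simp only [chooseSqPoly, finsetSum_coeff, coeff_C_mul_X_pow]
  rw [Finset.sum_ite_eq]
  split_ifs with h
  · rfl
  · rw [Nat.choose_eq_zero_of_lt (by simpa using h)]; simp

theorem chooseSqPoly_eval (l : ℕ) (z : ℝ) :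
    (chooseSqPoly l).eval z = ∑ k ∈ Finset.range (l + 1), (l.choose k : ℝ) ^ 2 * z ^ k := by
  simp [chooseSqPoly, Polynomial.eval_finsetSum]

theorem cast_choose_succ_mul (l k : ℕ) :
    (l.choose (k + 1) : ℝ) * (k + 1) = l.choose k * (l - k) := by
  rcases le_or_gt k l with h | h
  · have := Nat.choose_succ_right_eq l k
    rw [← Nat.cast_sub h]
    exact_mod_cast this
  · rw [Nat.choose_eq_zero_of_lt h, Nat.choose_eq_zero_of_lt (by omega)]; simp

open Polynomial in
/-- The hypergeometric differential equation satisfied by `∑ k, (l choose k)² X ^ k`. -/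
theorem chooseSqPoly_ode (l : ℕ) :
    X * derivative (derivative (chooseSqPoly l)) - X * (X * derivative (derivative (chooseSqPoly l)))
      + derivative (chooseSqPoly l) + C (2 * (l : ℝ) - 1) * (X * derivative (chooseSqPoly l))
      - C ((l : ℝ) ^ 2) * chooseSqPoly l = 0 := by
  ext k
  have key (j : ℕ) : ((j : ℝ) + 1) ^ 2 * (l.choose (j + 1) : ℝ) ^ 2
      = ((l : ℝ) - j) ^ 2 * (l.choose j : ℝ) ^ 2 := by
    have := congrArg (· ^ 2) (cast_choose_succ_mul l j)
    simp only [mul_pow] at this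
    linarith
  have h := key k
  simp only [coeff_add, coeff_sub, coeff_C_mul, coeff_zero]
  -- The factors X shift indices, so the two lowest coefficients are separate cases.
  rcases k with _ | _ | k
  all_goals
    simp only [coeff_derivative, chooseSqPoly_coeff, coeff_X_mul, coeff_X_mul_zero]
    push_cast at h ⊢
    linarith

theorem chooseSqPoly_ode_eval (l : ℕ) (z : ℝ) :
    z * (1 - z) * (chooseSqPoly l).derivative.derivative.eval z
      + (1 + (2 * l - 1) * z) * (chooseSqPoly l).derivative.eval z
      - l ^ 2 * (chooseSqPoly l).eval z = 0 := by
  have h := congrArg (Polynomial.eval z) (chooseSqPoly_ode l)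
  simp only [Polynomial.eval_add, Polynomial.eval_sub, Polynomial.eval_mul, Polynomial.eval_X,
    Polynomial.eval_C, Polynomial.eval_zero] at h
  linarith

theorem chooseSqPoly_eval_pos (l : ℕ) {z : ℝ} (hz : 0 ≤ z) : 0 < (chooseSqPoly l).eval z := by
  rw [chooseSqPoly_eval]
  refine Finset.sum_pos' (fun k _ => by positivity) ⟨0, by simp, by simp⟩

/-! ### The index as a function of y, and its second-order equation -/

/-- The index of coincidence of the binomial distribution with `l` trials and success
probability `(1 - y) / 2`. -/
noncomputable def binomialIndex (l : ℕ) (y : ℝ) : ℝ :=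
  ((1 + y) / 2) ^ (2 * l) * (chooseSqPoly l).eval (((1 - y) / (1 + y)) ^ 2)

/-- The derivative of `binomialIndex`. -/
noncomputable def binomialIndexDeriv (l : ℕ) (y : ℝ) : ℝ :=
  ((1 + y) / 2) ^ (2 * l) * (2 * l / (1 + y) * (chooseSqPoly l).eval (((1 - y) / (1 + y)) ^ 2)
    - 4 * (1 - y) / (1 + y) ^ 3 * (chooseSqPoly l).derivative.eval (((1 - y) / (1 + y)) ^ 2))

theorem hasDerivAt_moebius_sq {y : ℝ} (hy : 1 + y ≠ 0) :
    HasDerivAt (fun y : ℝ => ((1 - y) / (1 + y)) ^ 2) (-4 * (1 - y) / (1 + y) ^ 3) y := by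
  have h1 : HasDerivAt (fun y : ℝ => 1 - y) (-1) y := by
    simpa using (hasDerivAt_id y).const_sub 1
  have h2 : HasDerivAt (fun y : ℝ => 1 + y) 1 y := by
    simpa using (hasDerivAt_id y).const_add 1
  refine ((h1.div h2 hy).pow 2).congr_deriv ?_
  simp
  field_simp
  ring

theorem hasDerivAt_half_pow (l : ℕ) {y : ℝ} (hy : 1 + y ≠ 0) :
    HasDerivAt (fun y : ℝ => ((1 + y) / 2) ^ (2 * l))
      (((1 + y) / 2) ^ (2 * l) * (2 * l / (1 + y))) y := by
  have h2 : HasDerivAt (fun y : ℝ => (1 + y) / 2) (1 / 2) y := by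
    simpa using ((hasDerivAt_id y).const_add 1).div_const 2
  refine (h2.pow (2 * l)).congr_deriv ?_
  rcases l with _ | l
  · simp
  · rw [show 2 * (l + 1) - 1 = 2 * l + 1 by omega, show 2 * (l + 1) = 2 * l + 1 + 1 by ring,
      pow_succ _ (2 * l + 1)]
    push_cast
    field_simp
    ring

theorem hasDerivAt_binomialIndex (l : ℕ) {y : ℝ} (hy : 1 + y ≠ 0) :
    HasDerivAt (binomialIndex l) (binomialIndexDeriv l y) y := by
  have hA := ((chooseSqPoly l).hasDerivAt _).comp y (hasDerivAt_moebius_sq hy)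
  refine ((hasDerivAt_half_pow l hy).mul hA).congr_deriv ?_
  simp only [binomialIndexDeriv, Function.comp]
  ring

theorem hasDerivAt_binomialIndexDeriv (l : ℕ) {y : ℝ} (hy : 1 + y ≠ 0) (hy0 : y ≠ 0)
    (hy1 : 1 - y ≠ 0) :
    HasDerivAt (binomialIndexDeriv l)
      (((2 * l - (2 * l - 2) * y ^ 2) * binomialIndexDeriv l y - 2 * l * y * binomialIndex l y)
        / (y * (1 - y ^ 2))) y := by
  have hA := ((chooseSqPoly l).hasDerivAt _).comp y (hasDerivAt_moebius_sq hy)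
  have hB := ((chooseSqPoly l).derivative.hasDerivAt _).comp y (hasDerivAt_moebius_sq hy)
  have h1 : HasDerivAt (fun y : ℝ => 1 - y) (-1) y := by
    simpa using (hasDerivAt_id y).const_sub 1
  have h2 : HasDerivAt (fun y : ℝ => 1 + y) 1 y := by
    simpa using (hasDerivAt_id y).const_add 1
  have hF : HasDerivAt (fun y : ℝ => 2 * (l : ℝ) / (1 + y)) (-(2 * l) / (1 + y) ^ 2) y := by
    refine ((hasDerivAt_const y (2 * (l : ℝ))).div h2 hy).congr_deriv ?_
    ring
  have hE : HasDerivAt (fun y : ℝ => 4 * (1 - y) / (1 + y) ^ 3)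
      (-4 / (1 + y) ^ 3 - 12 * (1 - y) / (1 + y) ^ 4) y := by
    refine ((h1.const_mul 4).div (h2.pow 3) (pow_ne_zero 3 hy)).congr_deriv ?_
    simp
    field_simp
    ring
  have hfact : (1 - y ^ 2) = (1 - y) * (1 + y) := by ring
  refine ((hasDerivAt_half_pow l hy).mul ((hF.mul hA).sub (hE.mul hB))).congr_deriv ?_
  have ode := chooseSqPoly_ode_eval l (((1 - y) / (1 + y)) ^ 2)
  simp only [binomialIndexDeriv, binomialIndex, Function.comp, Pi.mul_apply, Pi.sub_apply]
  rw [hfact]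
  generalize (chooseSqPoly l).derivative.derivative.eval (((1 - y) / (1 + y)) ^ 2) = A2 at *
  generalize (chooseSqPoly l).derivative.eval (((1 - y) / (1 + y)) ^ 2) = A1 at *
  generalize (chooseSqPoly l).eval (((1 - y) / (1 + y)) ^ 2) = A0 at *
  generalize ((1 + y) / 2) ^ (2 * l) = P
  -- The hypergeometric equation solved for its top derivative, using 1 - z = 4y/(1+y)².
  have hode : A2 = (l ^ 2 * A0 - (1 + (2 * l - 1) * ((1 - y) / (1 + y)) ^ 2) * A1)
      * (1 + y) ^ 4 / (4 * y * (1 - y) ^ 2) := by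
    field_simp at ode ⊢
    linear_combination ode
  rw [hode]
  field_simp
  ring

theorem binomialIndex_pos (l : ℕ) {y : ℝ} (hy : -1 < y) : 0 < binomialIndex l y := by
  have : 0 < 1 + y := by linarith
  exact mul_pos (by positivity) (chooseSqPoly_eval_pos l (sq_nonneg _))

theorem binomialIndex_one (l : ℕ) : binomialIndex l 1 = 1 := by
  norm_num [binomialIndex, ← Polynomial.coeff_zero_eq_eval_zero, chooseSqPoly_coeff]

theorem binomialIndexDeriv_one (l : ℕ) : binomialIndexDeriv l 1 = l := by
  norm_num [binomialIndexDeriv, ← Polynomial.coeff_zero_eq_eval_zero, chooseSqPoly_coeff]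

/-! ### The Riccati comparison -/

/-- The discriminant root `√(L² u² + (1 - u)²)`. -/
noncomputable def discRoot (L u : ℝ) : ℝ := Real.sqrt (L ^ 2 * u ^ 2 + (1 - u) ^ 2)

theorem discRoot_sq (L u : ℝ) : discRoot L u ^ 2 = L ^ 2 * u ^ 2 + (1 - u) ^ 2 :=
  Real.sq_sqrt (by positivity)

theorem discRoot_nonneg (L u : ℝ) : 0 ≤ discRoot L u := Real.sqrt_nonneg _

theorem discRoot_arg_pos {L : ℝ} (hL : 1 ≤ L) (u : ℝ) : 0 < L ^ 2 * u ^ 2 + (1 - u) ^ 2 := by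
  rcases eq_or_ne u 1 with rfl | h
  · nlinarith
  · have : 1 - u ≠ 0 := fun h' => h (by linarith)
    positivity

theorem discRoot_pos {L : ℝ} (hL : 1 ≤ L) (u : ℝ) : 0 < discRoot L u :=
  Real.sqrt_pos.2 (discRoot_arg_pos hL u)

theorem hasDerivAt_discRoot {L : ℝ} (hL : 1 ≤ L) (u : ℝ) :
    HasDerivAt (discRoot L) (((L ^ 2 + 1) * u - 1) / discRoot L u) u := by
  have h1 : HasDerivAt (fun u : ℝ => 1 - u) (-1) u := by
    simpa using (hasDerivAt_id u).const_sub 1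
  refine ((((hasDerivAt_id u).pow 2).const_mul (L ^ 2)).add (h1.pow 2)).sqrt
    (discRoot_arg_pos hL u).ne' |>.congr_deriv ?_
  have : discRoot L u ≠ 0 := (discRoot_pos hL u).ne'
  change _ / (2 * discRoot L u) = _
  simp
  field_simp
  ring

theorem discRoot_zero (L : ℝ) : discRoot L 0 = 1 := by simp [discRoot]

/-- The smaller root `g` of `y (1 - y²) g² - (2L - (2L - 2) y²) g + 2 L y`. -/
noncomputable def riccatiRoot (L y : ℝ) : ℝ :=
  2 * L * y / (1 + (L - 1) * (1 - y ^ 2) + discRoot L (1 - y ^ 2))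

theorem riccatiRoot_den_pos {L y : ℝ} (hL : 1 ≤ L) (hy0 : 0 ≤ y) (hy1 : y ≤ 1) :
    0 < 1 + (L - 1) * (1 - y ^ 2) + discRoot L (1 - y ^ 2) := by
  have h1 := discRoot_pos hL (1 - y ^ 2)
  have : 0 ≤ (L - 1) * (1 - y ^ 2) := mul_nonneg (by linarith) (by nlinarith)
  linarith

theorem discRoot_ge {L u : ℝ} : 1 - u ≤ discRoot L u := by
  apply Real.le_sqrt_of_sq_le
  nlinarith [sq_nonneg (L * u)]

/-- The quadratic degenerates to a linear equation at y = 1; the rationalised form of the root stays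
finite there. -/
theorem riccatiRoot_one {L : ℝ} : riccatiRoot L 1 = L := by
  simp [riccatiRoot, discRoot_zero]
  ring

theorem riccatiRoot_mono {L y z : ℝ} (hL : 1 ≤ L) (hy : 0 < y) (hyz : y ≤ z) (hz : z ≤ 1) :
    riccatiRoot L y ≤ riccatiRoot L z := by
  have hz0 : 0 < z := hy.trans_le hyz
  have hdy := riccatiRoot_den_pos hL hy.le (hyz.trans hz)
  have hdz := riccatiRoot_den_pos hL hz0.le hz
  have hyz1 : y * z ≤ 1 := by nlinarith
  have hRy := discRoot_nonneg L (1 - y ^ 2)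
  have hRz := discRoot_nonneg L (1 - z ^ 2)
  -- The correction yz(z-y) = yz² - zy² is the exact defect when `discRoot L u` is replaced by its
  -- part 1 - u.
  have hR : y * discRoot L (1 - z ^ 2) ≤ z * discRoot L (1 - y ^ 2) + y * z * (z - y) := by
    have hge : y ^ 2 ≤ discRoot L (1 - y ^ 2) := by
      have := @discRoot_ge L (1 - y ^ 2); linarith
    have hpos : 0 ≤ y * z * (z - y) := by
      have : 0 ≤ z - y := by linarith
      positivity
    have hLsq : L ^ 2 * (y * (1 - z ^ 2)) ^ 2 ≤ L ^ 2 * (z * (1 - y ^ 2)) ^ 2 := by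
      have h1 : 0 ≤ 1 - z ^ 2 := by nlinarith
      have h2 : 1 - z ^ 2 ≤ 1 - y ^ 2 := by nlinarith
      gcongr
    have hcross : 0 ≤ (discRoot L (1 - y ^ 2) - y ^ 2) * (2 * z * (y * z * (z - y))) :=
      mul_nonneg (by linarith) (by positivity)
    refine (sq_le_sq₀ (by positivity) (by positivity)).1 ?_
    have h1 := discRoot_sq L (1 - z ^ 2)
    have h2 := discRoot_sq L (1 - y ^ 2)
    calc (y * discRoot L (1 - z ^ 2)) ^ 2 = L ^ 2 * (y * (1 - z ^ 2)) ^ 2 + y ^ 2 * z ^ 4 := by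
          rw [mul_pow, h1]; ring
      _ ≤ L ^ 2 * (z * (1 - y ^ 2)) ^ 2 + y ^ 2 * z ^ 4
          + (discRoot L (1 - y ^ 2) - y ^ 2) * (2 * z * (y * z * (z - y))) := by linarith
      _ = _ := by linear_combination (-z ^ 2) * h2
  unfold riccatiRoot
  rw [div_le_div_iff₀ hdy hdz]
  have key : 0 ≤ z * (1 + (L - 1) * (1 - y ^ 2) + discRoot L (1 - y ^ 2))
      - y * (1 + (L - 1) * (1 - z ^ 2) + discRoot L (1 - z ^ 2)) := by
    have : 0 ≤ (z - y) * (L * (1 + y * z) - 2 * (y * z)) :=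
      mul_nonneg (by linarith) (by nlinarith [mul_pos hy hz0])
    nlinarith
  nlinarith [mul_nonneg (by linarith : (0:ℝ) ≤ 2 * L) key]

/-- Sign of the Riccati right-hand side below its smaller root. -/
theorem riccati_rhs_neg {L y g : ℝ} (hL : 1 ≤ L) (hy0 : 0 < y) (hy1 : y < 1)
    (hg : g < riccatiRoot L y) :
    (2 * L - (2 * L - 2) * y ^ 2) * g - 2 * L * y - y * (1 - y ^ 2) * g ^ 2 < 0 := by
  have hd := riccatiRoot_den_pos hL hy0.le hy1.le
  have hsq := discRoot_sq L (1 - y ^ 2)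
  have hR := discRoot_pos hL (1 - y ^ 2)
  have hu : 0 < 1 - y ^ 2 := by nlinarith
  rw [riccatiRoot, lt_div_iff₀ hd] at hg
  set R := discRoot L (1 - y ^ 2)
  set a := 1 + (L - 1) * (1 - y ^ 2) with ha
  have hyu : 0 < y * (1 - y ^ 2) := by positivity
  -- So g is also below the larger root (a+R)/(y(1-y²)), and the quadratic has a definite sign.
  have h2 : y * (1 - y ^ 2) * g < a + R := by
    have : y * (1 - y ^ 2) * (g * (a + R)) < (a + R) * (a + R) := by
      have h3 : y * (1 - y ^ 2) * (g * (a + R)) < y * (1 - y ^ 2) * (2 * L * y) :=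
        mul_lt_mul_of_pos_left hg hyu
      have h4 : y * (1 - y ^ 2) * (2 * L * y) = a ^ 2 - R ^ 2 := by rw [hsq, ha]; ring
      have ha0 : 0 < a := by
        have : 0 ≤ (L - 1) * (1 - y ^ 2) := mul_nonneg (by linarith) hu.le
        linarith
      nlinarith [mul_pos ha0 hR]
    nlinarith
  have h5 := mul_pos (sub_pos.2 hg) (sub_pos.2 h2)
  have h6 : (a + R) * ((2 * L - (2 * L - 2) * y ^ 2) * g - 2 * L * y - y * (1 - y ^ 2) * g ^ 2)
      = -((2 * L * y - g * (a + R)) * (a + R - y * (1 - y ^ 2) * g)) := by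
    linear_combination (-g) * hsq + g * (a + (1 + (L-1)*(1-y^2))) * ha
  nlinarith

/-- Lower bound for the logarithmic derivative of the index of coincidence. -/
theorem riccatiRoot_le_logDeriv {l : ℕ} (hl : 1 ≤ l) {y : ℝ} (hy0 : 0 < y) (hy1 : y < 1) :
    riccatiRoot l y ≤ binomialIndexDeriv l y / binomialIndex l y := by
  by_contra! hlt
  have hL : (1 : ℝ) ≤ l := by exact_mod_cast hl
  set g : ℝ → ℝ := fun y => binomialIndexDeriv l y / binomialIndex l y with hg
  have hcontD : ContinuousOn (binomialIndexDeriv l) (Set.Icc y 1) := by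
    intro z hz
    have hz1 : 1 + z ≠ 0 := by linarith [hz.1]
    apply ContinuousAt.continuousWithinAt
    unfold binomialIndexDeriv
    have hmo := (hasDerivAt_moebius_sq hz1).continuousAt
    have h1 := (chooseSqPoly l).continuous.continuousAt.comp hmo
    have h2 := (chooseSqPoly l).derivative.continuous.continuousAt.comp hmo
    simp only [Function.comp_def] at h1 h2
    refine (hasDerivAt_half_pow l hz1).continuousAt.mul (ContinuousAt.sub (.mul ?_ h1) (.mul ?_ h2))
    · exact continuousAt_const.div (by fun_prop) hz1
    · exact ContinuousAt.div (by fun_prop) (by fun_prop) (pow_ne_zero 3 hz1)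
  have hcont : ContinuousOn g (Set.Icc y 1) := by
    refine hcontD.div (fun z hz => ?_) (fun z hz => (binomialIndex_pos l (by linarith [hz.1])).ne')
    exact (hasDerivAt_binomialIndex l (by linarith [hz.1])).continuousAt.continuousWithinAt
  -- The constant g(y) is a barrier: if g returns to it at z, then g(z) = g(y) < γ(y) ≤ γ(z) forces
  -- g'(z) < 0. Hence g(1) ≤ g(y) < γ(y) ≤ l, a contradiction.
  have hle := image_le_of_deriv_right_lt_deriv_boundary (f := g)
    (f' := fun z => ((2 * l - (2 * l - 2) * z ^ 2) * g z - 2 * l * z - z * (1 - z ^ 2) * g z ^ 2)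
      / (z * (1 - z ^ 2))) (B := fun _ => g y) (B' := fun _ => 0) hcont
    (fun z hz => ?_) le_rfl (fun _ => hasDerivAt_const _ _) (fun z hz hgz => ?_)
    (Set.right_mem_Icc.2 hy1.le)
  · have h1 : g 1 = l := by simp [hg, binomialIndex_one, binomialIndexDeriv_one]
    have h2 := riccatiRoot_mono hL hy0 hy1.le le_rfl
    rw [riccatiRoot_one] at h2
    rw [h1] at hle
    linarith
  · have hz0 : 0 < z := hy0.trans_le hz.1
    have hs := (binomialIndex_pos l (by linarith : -1 < z)).ne'
    refine (((hasDerivAt_binomialIndexDeriv l (by linarith) hz0.ne' (by linarith [hz.2])).div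
      (hasDerivAt_binomialIndex l (by linarith)) hs).congr_deriv ?_).hasDerivWithinAt
    have : 1 - z ^ 2 ≠ 0 := by nlinarith [hz.2]
    simp only [hg]
    field_simp
  · have hz0 : 0 < z := hy0.trans_le hz.1
    have hzy : 0 < z * (1 - z ^ 2) := mul_pos hz0 (by nlinarith [hz.2])
    refine div_neg_of_neg_of_pos (riccati_rhs_neg hL hz0 hz.2 ?_) hzy
    rw [hgz]
    exact hlt.trans_le (riccatiRoot_mono hL hy0 hz.1 hz.2.le)

/-! ### Integrating the bound -/

/-- The logarithm of the upper bound, as a function of `u = 4 x (1 - x)`. -/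
noncomputable def logBound (L r u : ℝ) : ℝ :=
  Real.log 2 - Real.log (1 - u + discRoot L u) + L * Real.log (discRoot L u + L * u)
    - r * (Real.log (r * discRoot L u + r ^ 2 * u - 1) - Real.log (r - 1))

theorem one_sub_add_discRoot_pos {L u : ℝ} (hL : 1 ≤ L) (hu1 : u ≤ 1) :
    0 < 1 - u + discRoot L u := by
  have := discRoot_pos hL u; linarith

theorem discRoot_add_pos {L u : ℝ} (hL : 1 ≤ L) (hu0 : 0 ≤ u) : 0 < discRoot L u + L * u := by
  have := discRoot_pos hL u
  have : 0 ≤ L * u := mul_nonneg (by linarith) hu0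
  linarith

/-- With R = `discRoot L u`, the identity r²R² = (1 - r²u)² + L² gives rR > |1 - r²u|. -/
theorem mul_discRoot_add_sub_pos {L r u : ℝ} (hL : 1 ≤ L) (hr : 0 ≤ r) (hr2 : r ^ 2 = L ^ 2 + 1) :
    0 < r * discRoot L u + r ^ 2 * u - 1 := by
  have h : 1 - r ^ 2 * u < r * discRoot L u := by
    apply lt_of_pow_lt_pow_left₀ 2 (mul_nonneg hr (discRoot_nonneg L u))
    rw [mul_pow, discRoot_sq]
    have : r ^ 2 * (L ^ 2 * u ^ 2 + (1 - u) ^ 2) = (1 - r ^ 2 * u) ^ 2 + L ^ 2 := by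
      rw [hr2]; ring
    nlinarith
  linarith

/-- The derivative is -γ(y)/y at u = 1 - y², so the chain rule turns it into 2γ(y). -/
theorem hasDerivAt_logBound {L r u : ℝ} (hL : 1 ≤ L) (hr : 0 ≤ r) (hr2 : r ^ 2 = L ^ 2 + 1)
    (hu0 : 0 < u) (hu1 : u < 1) :
    HasDerivAt (logBound L r) (-(2 * L) / (1 + (L - 1) * u + discRoot L u)) u := by
  have hR := hasDerivAt_discRoot hL u
  have hid := hasDerivAt_id u
  have p1 := one_sub_add_discRoot_pos hL hu1.le
  have p2 := discRoot_add_pos hL hu0.le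
  have p3 := mul_discRoot_add_sub_pos (u := u) hL hr hr2
  have hRpos := discRoot_pos hL u
  have hsq := discRoot_sq L u
  have d1 := ((hid.const_sub 1).add hR).log p1.ne'
  have d2 := (hR.add (hid.const_mul L)).log p2.ne'
  have d3 := (((hR.const_mul r).add (hid.const_mul (r ^ 2))).sub_const 1).log p3.ne'
  refine (((d1.const_sub (Real.log 2)).add (d2.const_mul L)).sub
    ((d3.sub_const (Real.log (r - 1))).const_mul r)).congr_deriv ?_
  simp only [Pi.add_apply, id]
  have p4 : 0 < 1 + (L - 1) * u + discRoot L u := by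
    have : 0 ≤ (L - 1) * u := mul_nonneg (by linarith) hu0.le
    linarith
  set R := discRoot L u
  have hu1' : 0 < 1 - u := by linarith
  -- The relation R² = L²u² + (1-u)² reduces every denominator to a product of R, u and 1 - u.
  have e1 : (-1 + ((L ^ 2 + 1) * u - 1) / R) / (1 - u + R) = (R - 1) / (R * u) := by
    rw [div_eq_div_iff p1.ne' (by positivity)]
    field_simp
    linear_combination (-1) * hsq
  have e2 : (((L ^ 2 + 1) * u - 1) / R + L * 1) / (R + L * u) = (L - R) / (R * (1 - u)) := by
    rw [div_eq_div_iff p2.ne' (by positivity)]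
    field_simp
    linear_combination hsq
  have e3 : (r * (((L ^ 2 + 1) * u - 1) / R) + r ^ 2 * 1) / (r * R + r ^ 2 * u - 1) = r / R := by
    rw [div_eq_div_iff p3.ne' (by positivity), ← hr2]
    field_simp
    ring
  have e4 : -(2 * L) / (1 + (L - 1) * u + R) = (R - (1 - u) - L * u) / (u * (1 - u)) := by
    rw [div_eq_div_iff p4.ne' (by positivity)]
    linear_combination -hsq
  rw [e1, e2, e3, e4]
  field_simp
  rw [hr2]
  linear_combination -hsq

theorem continuousAt_logBound {L r u : ℝ} (hL : 1 ≤ L) (hr : 0 ≤ r) (hr2 : r ^ 2 = L ^ 2 + 1)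
    (hu0 : 0 ≤ u) (hu1 : u ≤ 1) : ContinuousAt (logBound L r) u := by
  have hR := (hasDerivAt_discRoot hL u).continuousAt
  have p1 := (one_sub_add_discRoot_pos hL hu1).ne'
  have p2 := (discRoot_add_pos hL hu0).ne'
  have p3 := (mul_discRoot_add_sub_pos (u := u) hL hr hr2).ne'
  unfold logBound
  fun_prop (disch := assumption)

theorem logBound_zero {L r : ℝ} : logBound L r 0 = 0 := by
  simp [logBound, discRoot_zero]
  norm_num

theorem two_mul_log_binomialIndex_le {l : ℕ} (hl : 1 ≤ l) {r : ℝ} (hr : 0 ≤ r)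
    (hr2 : r ^ 2 = (l : ℝ) ^ 2 + 1) {y : ℝ} (hy0 : 0 ≤ y) (hy1 : y ≤ 1) :
    2 * Real.log (binomialIndex l y) ≤ logBound l r (1 - y ^ 2) := by
  have hL : (1 : ℝ) ≤ l := by exact_mod_cast hl
  have hmono : MonotoneOn
      (fun y => 2 * Real.log (binomialIndex l y) - logBound l r (1 - y ^ 2)) (Set.Icc 0 1) := by
    refine monotoneOn_of_hasDerivWithinAt_nonneg (f' := fun y => 2 * (binomialIndexDeriv l y
      / binomialIndex l y) - -(2 * l) / (1 + (l - 1) * (1 - y ^ 2) + discRoot l (1 - y ^ 2))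
        * (-(2 * y)))
      (convex_Icc 0 1) (fun z hz => ?_) (fun z hz => ?_) (fun z hz => ?_)
    · have hs := (hasDerivAt_binomialIndex l (by linarith [hz.1] : 1 + z ≠ 0)).continuousAt
      have hb : ContinuousAt (fun y : ℝ => logBound l r (1 - y ^ 2)) z :=
        ContinuousAt.comp (f := fun y : ℝ => 1 - y ^ 2) (continuousAt_logBound hL hr hr2
          (by nlinarith [hz.1, hz.2]) (by nlinarith)) (by fun_prop)
      exact ((continuousAt_const.mul (hs.log
        (binomialIndex_pos l (by linarith [hz.1])).ne')).sub hb).continuousWithinAt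
    · rw [interior_Icc] at hz
      have hs := hasDerivAt_binomialIndex l (by linarith [hz.1] : 1 + z ≠ 0)
      have hsq : HasDerivAt (fun y : ℝ => 1 - y ^ 2) (-(2 * z)) z := by
        simpa using ((hasDerivAt_id z).pow 2).const_sub 1
      have hb := (hasDerivAt_logBound hL hr hr2 (u := 1 - z ^ 2)
        (by nlinarith [hz.1, hz.2]) (by nlinarith [hz.1])).comp z hsq
      exact (((hs.log (binomialIndex_pos l (by linarith [hz.1])).ne').const_mul 2).sub
        hb).hasDerivWithinAt
    · rw [interior_Icc] at hz
      have h := riccatiRoot_le_logDeriv hl hz.1 hz.2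
      have e : -(2 * (l : ℝ)) / (1 + (l - 1) * (1 - z ^ 2) + discRoot l (1 - z ^ 2)) * (-(2 * z))
          = 2 * riccatiRoot l z := by
        rw [riccatiRoot]; ring
      rw [e]
      linarith
  have h := hmono ⟨hy0, hy1⟩ (Set.right_mem_Icc.2 zero_le_one) hy1
  simp only [binomialIndex_one] at h
  norm_num [logBound_zero] at h
  linarith

theorem binomialIndex_sq_le {l : ℕ} (hl : 1 ≤ l) {r : ℝ} (hr : 0 ≤ r)
    (hr2 : r ^ 2 = (l : ℝ) ^ 2 + 1) {y : ℝ} (hy0 : 0 ≤ y) (hy1 : y ≤ 1) {u : ℝ}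
    (hu : u = 1 - y ^ 2) :
    binomialIndex l y ^ 2 ≤ 2 / (1 - u + discRoot l u) * (1 / (discRoot l u + l * u)) ^ (-(l : ℝ))
      * ((r * discRoot l u + r ^ 2 * u - 1) / (r - 1)) ^ (-r) := by
  have hL : (1 : ℝ) ≤ l := by exact_mod_cast hl
  have hu0 : 0 ≤ u := by nlinarith
  have hu1 : u ≤ 1 := by nlinarith
  have p1 := one_sub_add_discRoot_pos hL hu1
  have p2 := discRoot_add_pos hL hu0
  have p3 := mul_discRoot_add_sub_pos (u := u) hL hr hr2
  have p4 : 0 < r - 1 := by nlinarith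
  have hs := binomialIndex_pos l (by linarith : -1 < y)
  have h := two_mul_log_binomialIndex_le hl hr hr2 hy0 hy1
  rw [← hu] at h
  have q1 := div_pos two_pos p1
  have q2 := Real.rpow_pos_of_pos (one_div_pos.2 p2) (-(l : ℝ))
  have q3 := Real.rpow_pos_of_pos (div_pos p3 p4) (-r)
  rw [← Real.log_le_log_iff (by positivity) (by positivity), Real.log_pow,
    Real.log_mul (by positivity) q3.ne', Real.log_mul q1.ne' q2.ne',
    Real.log_rpow (one_div_pos.2 p2), Real.log_rpow (div_pos p3 p4),
    Real.log_div two_ne_zero p1.ne', Real.log_div one_ne_zero p2.ne', Real.log_div p3.ne' p4.ne',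
    Real.log_one]
  unfold logBound at h
  push_cast
  linarith

/-! ### Return to the original parameters -/

theorem realBinom_natCast (l k : ℕ) : realBinom l k = l.choose k := by
  rw [realBinom, Nat.cast_choose_eq_descPochhammer_div, descPochhammer_eval_eq_prod_range]

theorem coincidenceIndex_eq_sum {c : ℝ} (hc : c < 0) (l : ℕ) (t : ℝ) :
    coincidenceIndex (-c * l) c t = ∑ k ∈ Finset.range (l + 1),
      (l.choose k : ℝ) ^ 2 * (-c * t) ^ (2 * k) * (1 + c * t) ^ (2 * (l - k)) := by
  have hlc : -(-c * (l : ℝ)) / c = l := by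
    rw [neg_mul, neg_neg, mul_div_cancel_left₀ _ hc.ne]
  have hw (k : ℕ) : probWeight (-c * l) c k t
      = l.choose k * (-c * t) ^ k * (1 + c * t) ^ ((l : ℝ) - k) := by
    rw [probWeight, if_neg hc.ne, hlc, realBinom_natCast]
  rw [coincidenceIndex, tsum_eq_sum (s := Finset.range (l + 1))]
  · refine Finset.sum_congr rfl fun k hk => ?_
    have hkl : k ≤ l := by simpa [Nat.lt_succ_iff] using hk
    rw [hw, ← Nat.cast_sub hkl, Real.rpow_natCast]
    ring
  · intro k hk
    rw [hw, Nat.choose_eq_zero_of_lt (by simpa using hk)]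
    simp

theorem binomialIndex_eq_sum (l : ℕ) {y : ℝ} (hy : 1 + y ≠ 0) :
    binomialIndex l y = ∑ k ∈ Finset.range (l + 1),
      (l.choose k : ℝ) ^ 2 * ((1 - y) / 2) ^ (2 * k) * ((1 + y) / 2) ^ (2 * (l - k)) := by
  rw [binomialIndex, chooseSqPoly_eval, Finset.mul_sum]
  refine Finset.sum_congr rfl fun k hk => ?_
  have hkl : k ≤ l := by simpa [Nat.lt_succ_iff] using hk
  have h : (1 - y) / 2 = (1 - y) / (1 + y) * ((1 + y) / 2) := by field_simp
  rw [h, show 2 * l = 2 * k + 2 * (l - k) by omega, mul_pow, ← pow_mul, pow_add]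
  ring

/-- The absolute value is harmless: a change of sign swaps the two probabilities, which the
reflection k ↦ l - k undoes. -/
theorem coincidenceIndex_eq_binomialIndex {c : ℝ} (hc : c < 0) (l : ℕ) (t : ℝ) :
    coincidenceIndex (-c * l) c t = binomialIndex l |1 + 2 * c * t| := by
  rw [coincidenceIndex_eq_sum hc,
    binomialIndex_eq_sum l (by have := abs_nonneg (1 + 2 * c * t); linarith)]
  rcases abs_choice (1 + 2 * c * t) with h | h <;> rw [h]
  · rw [show (1 - (1 + 2 * c * t)) / 2 = -c * t by ring,
      show (1 + (1 + 2 * c * t)) / 2 = 1 + c * t by ring]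
  · rw [show (1 - -(1 + 2 * c * t)) / 2 = 1 + c * t by ring,
      show (1 + -(1 + 2 * c * t)) / 2 = -c * t by ring, ← Finset.sum_range_reflect]
    refine Finset.sum_congr rfl fun k hk => ?_
    have hkl : k ≤ l := by simpa [Nat.lt_succ_iff] using hk
    rw [show l + 1 - 1 - k = l - k by omega, Nat.choose_symm hkl, Nat.sub_sub_self hkl,
      mul_right_comm]

theorem theorem4p1 (c : ℝ) (hc : c < 0) (l : ℕ) (hl : 1 ≤ l) (n : ℝ) (hn : n = -c * (l : ℝ))
    (t : ℝ) (ht : t ∈ Set.Icc (0 : ℝ) (-1 / c)) (T ρ R : ℝ) (hT : T = t + c * t ^ 2)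
    (hρ : ρ = Real.sqrt (n ^ 2 + c ^ 2))
    (hR : R = Real.sqrt (16 * ρ ^ 2 * T ^ 2 + 8 * c * T + 1)) :
    (coincidenceIndex n c t) ^ 2 ≤
      2 / (1 + 4 * c * T + R) * (1 / (R + 4 * n * T)) ^ (n / c) *
        ((ρ * R + 4 * ρ ^ 2 * T + c) / (ρ + c)) ^ (ρ / c) := by
  -- Scaling out -c leaves only l: n = -cl, ρ = -cr, and u = -4cT = 1 - (1+2ct)².
  set r : ℝ := Real.sqrt ((l : ℝ) ^ 2 + 1) with hr
  have hr0 : 0 ≤ r := Real.sqrt_nonneg _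
  have hr2 : r ^ 2 = (l : ℝ) ^ 2 + 1 := Real.sq_sqrt (by positivity)
  have hρr : ρ = -c * r := by
    rw [hρ, hr, hn, show (-c * (l : ℝ)) ^ 2 + c ^ 2 = (-c) ^ 2 * ((l : ℝ) ^ 2 + 1) by ring,
      Real.sqrt_mul (sq_nonneg _), Real.sqrt_sq (by linarith)]
  set u : ℝ := -4 * c * T with hu
  have hRu : R = discRoot l u := by
    rw [hR, discRoot]
    congr 1
    rw [hρr, mul_pow, hr2, hu]
    ring
  have hct : -1 ≤ c * t := by
    have := mul_le_mul_of_nonpos_left ht.2 hc.le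
    rwa [mul_div_cancel₀ _ hc.ne] at this
  have hct0 : c * t ≤ 0 := mul_nonpos_of_nonpos_of_nonneg hc.le ht.1
  have hmain := binomialIndex_sq_le hl hr0 hr2 (abs_nonneg (1 + 2 * c * t))
    (abs_le.2 ⟨by linarith, by linarith⟩) (u := u) (by rw [sq_abs, hu, hT]; ring)
  rw [← coincidenceIndex_eq_binomialIndex hc l t, ← hn, ← hRu] at hmain
  convert hmain using 2
  · congr 2
    · rw [hu]; ring
    · rw [hn, hu]; ring
    · rw [hn, neg_mul, neg_div, mul_div_cancel_left₀ _ hc.ne]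
  · rw [hρr, show -c * r * R + 4 * (-c * r) ^ 2 * T + c = -c * (r * R + r ^ 2 * u - 1) by
      rw [hu]; ring, show -c * r + c = -c * (r - 1) by ring,
      mul_div_mul_left _ _ (neg_ne_zero.2 hc.ne), neg_mul, neg_div,
      mul_div_cancel_left₀ _ hc.ne]
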